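/- Let $\mathrm{Cu}_2$ be the second Cuntz semigroup (polycyclic monoid): the involutive monoid with identity $e$ and zero element $\lozenge$, generated by $s_1,s_2,s_1^*,s_2^*$ subject to $s_1^*s_1=e=s_2^*s_2$ and $s_1^*s_2=\lozenge=s_2^*s_1$. For a finite (possibly empty) word $\mathbf i=(i_1,\dots,i_n)$ in $\{1,2\}$ put $s_{\mathbf i}=s_{i_1}\cdots s_{i_n}$ (with $s_\emptyset=e$) and $s_{\mathbf i}^*=(s_{\mathbf i})^*$; every $v\in\mathrm{Cu}_2\setminus\{\lozenge\}$ can be written as $v=s_{\mathbf i}s_{\mathbf j}^*$ for unique finite words $\mathbf i,\mathbf j$. Let $\mathcal A=(\ell^1(\mathrm{Cu}_2\setminus\{\lozenge\}),\#)$ be the complex unital Banach algebra whose (bounded bilinear) product is determined by $\delta_s\#\delta_t=\delta_{st}$ if $st\neq\lozenge$ and $\delta_s\#\delta_t=0$ if $st=\lozenge$; its unit is $\delta_e$. Let $\mathcal J$ be the closed two-sided ideal of $\mathcal A$ generated by $f_0=\delta_e-\delta_{s_1s_1^*}-\delta_{s_2s_2^*}$, and let $$\mathcal M_{\mathcal A}=\{a\in\mathcal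 A:\text{there are no } b,c\in\mathcal A\text{ with } b\# a\# c=\delta_e\}.$$ An element $v=s_{\mathbf i}s_{\mathbf j}^*$ of $\mathrm{Cu}_2\setminus\{\lozenge\}$ is *symmetric* if $\mathbf i=\mathbf j$. An element $t$ is a *proper symmetric expansion* of $r=s_{\mathbf m}s_{\mathbf n}^*$ if $t=s_{\mathbf m}us_{\mathbf n}^*$ for some symmetric $u\neq e$. An element of $\mathrm{Cu}_2\setminus\{\lozenge\}$ is *without symmetric core* if it is not a proper symmetric expansion of any element of $\mathrm{Cu}_2\setminus\{\lozenge\}$. For $f\in\mathcal A$ and $v=s_{\mathbf i}s_{\mathbf j}^*\in\mathrm{Cu}_2\setminus\{\lozenge\}$, we say that $f$ *has zero sums at* $v$ if for every infinite sequence $\mathbf n=(n_1,n_2,\dots)$ in $\{1,2\}$, with initial segments $\mathbf n_l=(n_1,\dots,n_l)$, $$\sum_{l=0}^\infty f\bigl(s_{\mathbf i\mathbf n_l}s_{\mathbf j\mathbf n_l}^*\bigr)=0 .$$ **Theorem.** For every $f\in\mathcal A$ the following are equivalent: 1. $f\in\mathcal J$; 2. $f$ has zero sums at every $v\in\mathrm{Cu}_2\setminus\{\lozenge\}$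 without symmetric core; 3. there are no $g,h\in\mathcal A$ with $g\# f\# h=\delta_e$. Consequently $\mathcal J=\mathcal M_{\mathcal A}$, and $\mathcal J$ is the unique maximal two-sided ideal of $\mathcal A$. -/

import Mathlib

noncomputable section

/-! ### The second Cuntz semigroup (polycyclic monoid) -/

namespace Cuntz

/-- The letters `s₁, s₂, s₁*, s₂*, ◇` (the index set `{1, 2}` is `Fin 2`). -/
inductive Letter : Type
  | s (i : Fin 2)
  | sStar (i : Fin 2)
  | zero

open FreeMonoid in
/-- The defining relations: `sᵢ* sᵢ = e`, `sᵢ* sⱼ = ◇` for `i ≠ j`, and `◇` is a zero element. -/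
inductive Rel : FreeMonoid Letter → FreeMonoid Letter → Prop
  | star_mul_self (i : Fin 2) : Rel (of (.sStar i) * of (.s i)) 1
  | star_mul_of_ne (i j : Fin 2) (h : i ≠ j) : Rel (of (.sStar i) * of (.s j)) (of .zero)
  | zero_mul (x : Letter) : Rel (of .zero * of x) (of .zero)
  | mul_zero (x : Letter) : Rel (of x * of .zero) (of .zero)

/-- The Cuntz semigroup `Cu₂`, given by generators and relations. Its identity `e` is written `1`
and its zero element `◇` is written `0`. -/
def Cu₂ : Type := PresentedMonoid Rel

namespace Cu₂

instance : Monoid Cu₂ := inferInstanceAs (Monoid (PresentedMonoid Rel))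

/-- The element of `Cu₂` given by a letter. -/
def ofLetter (x : Letter) : Cu₂ := PresentedMonoid.of Rel x

/-- The generators `s₁, s₂`. -/
def s (i : Fin 2) : Cu₂ := ofLetter (.s i)

instance : Zero Cu₂ := ⟨ofLetter .zero⟩

theorem zero_def : (0 : Cu₂) = ofLetter .zero := rfl

theorem mk_eq_of_rel {x y : FreeMonoid Letter} (h : Rel x y) :
    (PresentedMonoid.mk Rel x : Cu₂) = PresentedMonoid.mk Rel y :=
  PresentedMonoid.mk_eq_mk_of_rel h

@[elab_as_elim]
theorem letter_induction {P : Cu₂ → Prop} (one : P 1)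
    (mul : ∀ x t, P t → P (ofLetter x * t)) (t : Cu₂) : P t := by
  obtain ⟨w, rfl⟩ := PresentedMonoid.surjective_mk (rels := Rel) t
  induction w using FreeMonoid.inductionOn' with
  | one => exact one
  | of_mul x w ih => exact mul x _ ih

theorem ofLetter_mul_zero (x : Letter) : ofLetter x * 0 = 0 := mk_eq_of_rel (.mul_zero x)

theorem zero_mul_ofLetter (x : Letter) : 0 * ofLetter x = 0 := mk_eq_of_rel (.zero_mul x)

instance : MonoidWithZero Cu₂ where
  zero_mul t := by
    induction t using letter_induction with
    | one => exact mul_one _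
    | mul x t ih => rw [← mul_assoc, zero_mul_ofLetter, ih]
  mul_zero t := by
    induction t using letter_induction with
    | one => exact one_mul _
    | mul x t ih => rw [mul_assoc, ih, ofLetter_mul_zero]

/-- The involution on letters. -/
def letterStar : Letter → Letter
  | .s i => .sStar i
  | .sStar i => .s i
  | .zero => .zero

/-- The involution of `Cu₂` as a homomorphism to the opposite monoid. -/
def starHom : Cu₂ →* Cu₂ᵐᵒᵖ :=
  PresentedMonoid.lift (fun x => MulOpposite.op (ofLetter (letterStar x))) (by
    intro a b h
    apply MulOpposite.unop_injective
    cases h with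
    | star_mul_self i => exact mk_eq_of_rel (.star_mul_self i)
    | star_mul_of_ne i j h => exact mk_eq_of_rel (.star_mul_of_ne j i h.symm)
    | zero_mul x => exact mk_eq_of_rel (.mul_zero (letterStar x))
    | mul_zero x => exact mk_eq_of_rel (.zero_mul (letterStar x)))

theorem unop_starHom_ofLetter (x : Letter) :
    (starHom (ofLetter x)).unop = ofLetter (letterStar x) := rfl

instance : StarMul Cu₂ where
  star t := (starHom t).unop
  star_mul a b := by rw [map_mul, MulOpposite.unop_mul]
  star_involutive t := by
    induction t using letter_induction with
    | one =>
      change (starHom (starHom 1).unop).unop = 1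
      rw [map_one, MulOpposite.unop_one, map_one, MulOpposite.unop_one]
    | mul x t ih =>
      change (starHom (starHom t).unop).unop = t at ih
      change (starHom (starHom (ofLetter x * t)).unop).unop = _
      rw [map_mul, MulOpposite.unop_mul, map_mul, MulOpposite.unop_mul, ih,
        unop_starHom_ofLetter, unop_starHom_ofLetter]
      cases x <;> rfl

theorem star_s (i : Fin 2) : star (s i) = ofLetter (.sStar i) := rfl

theorem star_s_mul_s (i : Fin 2) : star (s i) * s i = 1 := mk_eq_of_rel (.star_mul_self i)

theorem star_s_mul_s_of_ne {i j : Fin 2} (h : i ≠ j) : star (s i) * s j = 0 :=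
  mk_eq_of_rel (.star_mul_of_ne i j h)

/-- The action of letters on finite words by partial maps: `sᵢ` prepends `i`, `sᵢ*` removes a
leading `i`. It serves to show that `Cu₂` does not collapse. -/
def letterAct : Letter → Function.End (Option (List (Fin 2)))
  | .s i => fun x => x.map (List.cons i)
  | .sStar i => fun x => x.bind fun w => if w.head? = some i then some w.tail else none
  | .zero => fun _ => none

/-- The action of `Cu₂` on finite words by partial maps. -/
def act : Cu₂ →* Function.End (Option (List (Fin 2))) :=
  PresentedMonoid.lift letterAct (by
    intro a b h
    cases h with
    | star_mul_self i =>
      funext x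
      change letterAct (.sStar i) (letterAct (.s i) x) = x
      cases x <;> simp [letterAct]
    | star_mul_of_ne i j h =>
      funext x
      change letterAct (.sStar i) (letterAct (.s j) x) = none
      cases x <;> simp [letterAct, h.symm]
    | zero_mul x => rfl
    | mul_zero x =>
      funext y
      change letterAct x none = none
      cases x <;> rfl)

instance : Nontrivial Cu₂ :=
  ⟨0, 1, fun h => by
    have h1 : act 0 (some []) = act 1 (some []) := by rw [h]
    rw [map_one] at h1
    exact Option.some_ne_none _ (h1 : (none : Option (List (Fin 2))) = some []).symm⟩

/-- `s_𝐢 = s_{i₁} ⋯ s_{iₙ}` for a finite word `𝐢` (and `e` for the empty word). -/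
def sWord (i : List (Fin 2)) : Cu₂ := (i.map s).prod

theorem star_sWord_mul_sWord (i : List (Fin 2)) : star (sWord i) * sWord i = 1 := by
  induction i with
  | nil => simp [sWord]
  | cons a i ih =>
    have h : sWord (a :: i) = s a * sWord i := by simp [sWord]
    rw [h, star_mul, mul_assoc, ← mul_assoc (star (s a)), star_s_mul_s, one_mul, ih]

theorem sWord_mul_star_ne_zero (i j : List (Fin 2)) : sWord i * star (sWord j) ≠ 0 := by
  intro h
  have h1 : star (sWord i) * (sWord i * star (sWord j)) * sWord j = 1 := by
    rw [← mul_assoc, star_sWord_mul_sWord, one_mul, star_sWord_mul_sWord]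
  rw [h, mul_zero, zero_mul] at h1
  exact zero_ne_one h1

theorem sWord_nil : sWord [] = 1 := by simp [sWord]

theorem sWord_cons (a : Fin 2) (i : List (Fin 2)) : sWord (a :: i) = s a * sWord i := by
  simp [sWord]

theorem sWord_append (i j : List (Fin 2)) : sWord (i ++ j) = sWord i * sWord j := by
  simp [sWord]

theorem eq_zero_or_exists (t : Cu₂) :
    t = 0 ∨ ∃ i j : List (Fin 2), t = sWord i * star (sWord j) := by
  induction t using letter_induction with
  | one => exact .inr ⟨[], [], by simp [sWord_nil]⟩
  | mul x t ih =>
    rcases ih with rfl | ⟨i, j, rfl⟩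
    · exact .inl (mul_zero _)
    cases x with
    | zero => exact .inl (by rw [← zero_def, zero_mul])
    | s a => exact .inr ⟨a :: i, j, by rw [sWord_cons, mul_assoc]; rfl⟩
    | sStar a =>
      rw [← star_s]
      cases i with
      | nil => exact .inr ⟨[], j ++ [a], by
          simp [sWord_nil, sWord_append, sWord_cons, star_mul]⟩
      | cons b i =>
        rw [sWord_cons, mul_assoc, ← mul_assoc]
        by_cases hab : a = b
        · subst hab
          exact .inr ⟨i, j, by rw [star_s_mul_s, one_mul]⟩
        · exact .inl (by rw [star_s_mul_s_of_ne hab, zero_mul])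

theorem act_mul (a b : Cu₂) (x : Option (List (Fin 2))) : act (a * b) x = act a (act b x) := by
  rw [map_mul]; rfl

theorem act_none (t : Cu₂) : act t none = none := by
  rw [show (none : Option (List (Fin 2))) = act 0 none from rfl, ← act_mul, mul_zero]

theorem act_sWord (i x : List (Fin 2)) : act (sWord i) (some x) = some (i ++ x) := by
  induction i with
  | nil => rw [sWord_nil, map_one]; rfl
  | cons a i ih => rw [sWord_cons, act_mul, ih]; rfl

theorem act_star_s (a : Fin 2) (x : List (Fin 2)) :
    act (star (s a)) (some x) = if x.head? = some a then some x.tail else none := rfl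

theorem act_star_sWord_self (j x : List (Fin 2)) :
    act (star (sWord j)) (some (j ++ x)) = some x := by
  rw [← act_sWord, ← act_mul, star_sWord_mul_sWord, map_one]; rfl

theorem prefix_of_act_star_sWord (j x : List (Fin 2)) (h : act (star (sWord j)) (some x) ≠ none) :
    j <+: x := by
  induction j generalizing x with
  | nil => exact List.nil_prefix
  | cons a j ih =>
    rw [sWord_cons, star_mul, act_mul, act_star_s] at h
    split_ifs at h with hx
    · cases x with
      | nil => simp at hx
      | cons b x =>
        simp only [List.head?_cons, Option.some.injEq] at hx
        subst hx
        exact (List.prefix_cons_inj b).2 (ih x h)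
    · exact absurd (act_none _) h

theorem eq_of_sWord_mul_star {i j k l : List (Fin 2)}
    (h : sWord i * star (sWord j) = sWord k * star (sWord l)) : i = k ∧ j = l := by
  have key : ∀ {i j k l : List (Fin 2)}, sWord i * star (sWord j) = sWord k * star (sWord l) →
      act (sWord k) (act (star (sWord l)) (some j)) = some i := fun {i j k l} h => by
    rw [← act_mul, ← h, act_mul]
    have h1 := act_star_sWord_self j []
    rw [List.append_nil] at h1
    rw [h1, act_sWord, List.append_nil]
  have pre : ∀ {i j k l : List (Fin 2)}, sWord i * star (sWord j) = sWord k * star (sWord l) →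
      l <+: j := fun {i j k l} h => prefix_of_act_star_sWord l j fun h0 => by
    have h1 := key h
    rw [h0, act_none] at h1
    exact Option.some_ne_none _ h1.symm
  have e : j = l := (pre h.symm).eq_of_length_le (pre h).length_le
  subst e
  refine ⟨?_, rfl⟩
  have h1 := key h
  have h2 := act_star_sWord_self j []
  rw [List.append_nil] at h2
  rw [h2, act_sWord, List.append_nil] at h1
  exact (Option.some.inj h1).symm

end Cu₂

/-- The set `Cu₂ ∖ {◇}`. -/
abbrev Cu₂Star : Type := {t : Cu₂ // t ≠ 0}

/-- The element `s_𝐢 s_𝐣*` of `Cu₂ ∖ {◇}`. -/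
def elt (i j : List (Fin 2)) : Cu₂Star :=
  ⟨Cu₂.sWord i * star (Cu₂.sWord j), Cu₂.sWord_mul_star_ne_zero i j⟩

/-- Every element of `Cu₂ ∖ {◇}` has the form `s_𝐢 s_𝐣*` for unique `𝐢, 𝐣`. -/
theorem existsUnique_elt (v : Cu₂Star) :
    ∃! p : List (Fin 2) × List (Fin 2), v = elt p.1 p.2 := by
  rcases Cu₂.eq_zero_or_exists v with h | ⟨i, j, h⟩
  · exact absurd h v.2
  · refine ⟨(i, j), Subtype.ext h, fun p hp => ?_⟩
    have e := Cu₂.eq_of_sWord_mul_star (h.symm.trans (congrArg Subtype.val hp))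
    exact Prod.ext e.1.symm e.2.symm

end Cuntz

/-! ### The Banach algebra `ℓ¹(S ∖ {◇})` of a monoid with zero -/

/-- The Banach space `ℓ¹(S ∖ {0})`, for a monoid with zero `S`. -/
abbrev EllOne (S : Type) [MonoidWithZero S] : Type :=
  lp (fun _ : {t : S // t ≠ 0} => ℂ) 1

namespace EllOne

variable {S : Type} [MonoidWithZero S]

open scoped Classical in
/-- The point mass `δ_s`, with the convention `δ_◇ = 0`. -/
def δ (s : S) : EllOne S := if h : s ≠ 0 then lp.single 1 ⟨s, h⟩ 1 else 0

theorem norm_δ_le (s : S) : ‖δ s‖ ≤ 1 := by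
  classical
  unfold δ
  split_ifs with h
  · rw [lp.norm_single one_pos]; simp
  · simp

theorem δ_zero : δ (0 : S) = 0 := by simp [δ]

theorem hasSum_norm (f : EllOne S) : HasSum (fun t => ‖f t‖) ‖f‖ := by
  simpa using lp.hasSum_norm (p := 1) (by simp) f

theorem δ_of_ne (t : {t : S // t ≠ 0}) [DecidableEq {t : S // t ≠ 0}] :
    δ (t : S) = lp.single 1 t (1 : ℂ) := by
  unfold δ
  rw [dif_pos t.2]
  congr 1
  exact Subsingleton.elim _ _

theorem hasSum_δ (f : EllOne S) : HasSum (fun t => f t • δ (t : S)) f := by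
  classical
  have h := lp.hasSum_single (p := 1) (by simp) f
  have e : (fun t => f t • δ (t : S)) = fun t => lp.single 1 t (f t) := by
    funext t
    rw [δ_of_ne, ← lp.single_smul, smul_eq_mul, mul_one]
  rw [e]
  exact h

theorem clm_ext {F : Type*} [NormedAddCommGroup F] [NormedSpace ℂ F] {φ ψ : EllOne S →L[ℂ] F}
    (h : ∀ t : S, t ≠ 0 → φ (δ t) = ψ (δ t)) : φ = ψ := by
  ext f
  refine HasSum.unique (φ.hasSum (hasSum_δ f)) ?_
  convert ψ.hasSum (hasSum_δ f) using 2 with t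
  simp [h t t.2]

/-- The terms `f(s) g(t) δ_{st}`, whose sum over all `s, t ∈ S ∖ {◇}` is `f # g`. -/
def mulTerm (f g : EllOne S) (p : {t : S // t ≠ 0} × {t : S // t ≠ 0}) : EllOne S :=
  (f p.1 * g p.2) • δ ((p.1 : S) * p.2)

theorem hasSum_norm_mul (f g : EllOne S) :
    HasSum (fun p : {t : S // t ≠ 0} × {t : S // t ≠ 0} => ‖f p.1‖ * ‖g p.2‖) (‖f‖ * ‖g‖) :=
  (hasSum_norm f).mul (hasSum_norm g)
    ((hasSum_norm f).summable.mul_of_nonneg (hasSum_norm g).summable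
      (fun _ => norm_nonneg _) (fun _ => norm_nonneg _))

theorem norm_mulTerm_le (f g : EllOne S) (p : {t : S // t ≠ 0} × {t : S // t ≠ 0}) :
    ‖mulTerm f g p‖ ≤ ‖f p.1‖ * ‖g p.2‖ := by
  unfold mulTerm
  rw [norm_smul, norm_mul]
  exact mul_le_of_le_one_right (by positivity) (norm_δ_le _)

theorem summable_mulTerm (f g : EllOne S) : Summable (mulTerm f g) :=
  Summable.of_norm_bounded (hasSum_norm_mul f g).summable (norm_mulTerm_le f g)

/-- The product `f # g = ∑_{s, t} f(s) g(t) δ_{st}` (with `δ_◇ = 0`). -/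
instance : Mul (EllOne S) := ⟨fun f g => ∑' p, mulTerm f g p⟩

theorem mul_def (f g : EllOne S) : f * g = ∑' p, mulTerm f g p := rfl

theorem norm_mul_le' (f g : EllOne S) : ‖f * g‖ ≤ ‖f‖ * ‖g‖ :=
  tsum_of_norm_bounded (hasSum_norm_mul f g) (norm_mulTerm_le f g)

theorem add_mul' (f g h : EllOne S) : (f + g) * h = f * h + g * h := by
  rw [mul_def, mul_def, mul_def, ← (summable_mulTerm f h).tsum_add (summable_mulTerm g h)]
  refine tsum_congr fun p => ?_
  simp [mulTerm, add_mul, add_smul]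

theorem mul_add' (f g h : EllOne S) : f * (g + h) = f * g + f * h := by
  rw [mul_def, mul_def, mul_def, ← (summable_mulTerm f g).tsum_add (summable_mulTerm f h)]
  refine tsum_congr fun p => ?_
  simp [mulTerm, mul_add, add_smul]

theorem smul_mul' (c : ℂ) (f g : EllOne S) : (c • f) * g = c • (f * g) := by
  rw [mul_def, mul_def, ← (summable_mulTerm f g).tsum_const_smul]
  refine tsum_congr fun p => ?_
  simp [mulTerm, mul_assoc, mul_smul]

theorem mul_smul' (c : ℂ) (f g : EllOne S) : f * (c • g) = c • (f * g) := by
  rw [mul_def, mul_def, ← (summable_mulTerm f g).tsum_const_smul]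
  refine tsum_congr fun p => ?_
  simp [mulTerm, mul_left_comm _ c, mul_smul]

/-- The product as a bounded bilinear map. -/
def mulL : EllOne S →L[ℂ] EllOne S →L[ℂ] EllOne S :=
  LinearMap.mkContinuous₂
    (LinearMap.mk₂ ℂ (fun f g => f * g) add_mul' smul_mul' mul_add' mul_smul') 1
    (fun f g => by simpa using norm_mul_le' f g)

theorem mulL_apply (f g : EllOne S) : mulL f g = f * g := rfl

/-- The product satisfies `δ_s # δ_t = δ_{st}`, which is `0` if `st = ◇`. -/
theorem δ_mul_δ (s t : S) : (δ s * δ t : EllOne S) = δ (s * t) := by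
  classical
  by_cases hs : s = 0
  · subst hs
    rw [δ_zero, zero_mul, δ_zero, ← mulL_apply, map_zero]
    rfl
  by_cases ht : t = 0
  · subst ht
    rw [δ_zero, mul_zero, δ_zero, ← mulL_apply, map_zero]
  have es : δ s = lp.single 1 (⟨s, hs⟩ : {t : S // t ≠ 0}) (1 : ℂ) := δ_of_ne ⟨s, hs⟩
  have et : δ t = lp.single 1 (⟨t, ht⟩ : {t : S // t ≠ 0}) (1 : ℂ) := δ_of_ne ⟨t, ht⟩
  rw [mul_def, tsum_eq_single (⟨s, hs⟩, ⟨t, ht⟩)]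
  · simp [mulTerm, es, et]
  · rintro ⟨a, b⟩ hab
    by_cases ha : a = ⟨s, hs⟩
    · have hb : b ≠ ⟨t, ht⟩ := fun hb => hab (by rw [ha, hb])
      simp [mulTerm, et, hb]
    · simp [mulTerm, es, ha]

/-- The unit is `δ_e`. -/
instance : One (EllOne S) := ⟨δ 1⟩

theorem one_def : (1 : EllOne S) = δ 1 := rfl

theorem one_mul' (f : EllOne S) : 1 * f = f := by
  have h : mulL (1 : EllOne S) = ContinuousLinearMap.id ℂ (EllOne S) :=
    clm_ext fun t _ => by
      rw [mulL_apply, one_def, δ_mul_δ, one_mul, ContinuousLinearMap.id_apply]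
  exact congrArg (fun φ => φ f) h

theorem mul_one' (f : EllOne S) : f * 1 = f := by
  have h : mulL.flip (1 : EllOne S) = ContinuousLinearMap.id ℂ (EllOne S) :=
    clm_ext fun t _ => by
      rw [ContinuousLinearMap.flip_apply, mulL_apply, one_def, δ_mul_δ, mul_one,
        ContinuousLinearMap.id_apply]
  exact congrArg (fun φ => φ f) h

theorem mul_assoc' (f g h : EllOne S) : f * g * h = f * (g * h) := by
  have h1 : ∀ s t : S, ∀ h : EllOne S, δ s * δ t * h = δ s * (δ t * h) := fun s t h => by
    have e : mulL (δ s * δ t) = (mulL (δ s)).comp (mulL (δ t)) := clm_ext fun u _ => by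
      simp only [ContinuousLinearMap.comp_apply, mulL_apply, δ_mul_δ, mul_assoc]
    exact congrArg (fun φ => φ h) e
  have h2 : ∀ s : S, ∀ g h : EllOne S, δ s * g * h = δ s * (g * h) := fun s g h => by
    have e : (mulL.flip h).comp (mulL (δ s)) = (mulL (δ s)).comp (mulL.flip h) :=
      clm_ext fun u _ => by
        simp only [ContinuousLinearMap.comp_apply, ContinuousLinearMap.flip_apply, mulL_apply, h1]
    exact congrArg (fun φ => φ g) e
  have e : (mulL.flip h).comp (mulL.flip g) = mulL.flip (g * h) := clm_ext fun u _ => by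
    simp only [ContinuousLinearMap.comp_apply, ContinuousLinearMap.flip_apply, mulL_apply, h2]
  exact congrArg (fun φ => φ f) e

theorem zero_mul' (f : EllOne S) : 0 * f = 0 := by
  rw [← mulL_apply, map_zero]; rfl

theorem mul_zero' (f : EllOne S) : f * 0 = 0 := by
  rw [← mulL_apply, map_zero]

/-- `ℓ¹(S ∖ {◇})` with the product `#` is a normed ring. -/
instance : NormedRing (EllOne S) where
  __ := (inferInstance : NormedAddCommGroup (EllOne S))
  left_distrib := mul_add'
  right_distrib := add_mul'
  zero_mul := zero_mul'
  mul_zero := mul_zero'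
  mul_assoc := mul_assoc'
  one_mul := one_mul'
  mul_one := mul_one'
  norm_mul_le := norm_mul_le'

instance : Algebra ℂ (EllOne S) := Algebra.ofModule smul_mul' mul_smul'

/-- `ℓ¹(S ∖ {◇})` with the product `#` is a complex normed algebra. -/
instance : NormedAlgebra ℂ (EllOne S) where
  norm_smul_le := norm_smul_le

end EllOne

/-! ### The algebra `𝒜`, its ideal `𝒥`, and zero sums -/

namespace Cuntz

/-- The Banach algebra `𝒜 = (ℓ¹(Cu₂ ∖ {◇}), #)`. -/
abbrev 𝒜 : Type := EllOne Cu₂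

open EllOne Cu₂

/-- The element `f₀ = δ_e - δ_{s₁ s₁*} - δ_{s₂ s₂*}`. -/
def f₀ : 𝒜 := δ 1 - δ (s 0 * star (s 0)) - δ (s 1 * star (s 1))

/-- The closed two-sided ideal of `𝒜` generated by `f₀`, i.e. the smallest closed two-sided ideal
that contains `f₀`. -/
def 𝒥 : TwoSidedIdeal 𝒜 := sInf {I | IsClosed (I : Set 𝒜) ∧ f₀ ∈ I}

/-- For a unital ring `A`, the set of the elements through which `1` does not factor. -/
def nonFactoring (A : Type*) [Ring A] : Set A := {a | ¬ ∃ b c : A, b * a * c = 1}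

/-- The initial segment `𝐧_l = (n₁, …, n_l)` of an infinite sequence `𝐧` (indexed from `0`). -/
def initial (n : ℕ → Fin 2) (l : ℕ) : List (Fin 2) := List.ofFn fun k : Fin l => n k

/-- `f` has zero sums at `v = s_𝐢 s_𝐣*`: for every infinite sequence `𝐧` the sum over `l ≥ 0` of
`f(s_{𝐢 𝐧_l} s_{𝐣 𝐧_l}*)` is `0`. The words `𝐢, 𝐣` exist and are unique for a
given `v` (`existsUnique_elt`). -/
def HasZeroSumsAt (f : 𝒜) (v : Cu₂Star) : Prop :=
  ∀ i j : List (Fin 2), v = elt i j → ∀ n : ℕ → Fin 2,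
    HasSum (fun l : ℕ => f (elt (i ++ initial n l) (j ++ initial n l))) 0

/-- An element `s_𝐢 s_𝐣*` is symmetric if `𝐢 = 𝐣`. -/
def IsSymmetric (t : Cu₂Star) : Prop := ∃ i : List (Fin 2), t = elt i i

/-- `t` is a proper symmetric expansion of `r = s_𝐦 s_𝐧*` if `t = s_𝐦 u s_𝐧*` for some symmetric
`u ≠ e`. -/
def IsProperSymmetricExpansion (t r : Cu₂Star) : Prop :=
  ∃ (m n : List (Fin 2)) (u : Cu₂Star), r = elt m n ∧ IsSymmetric u ∧ (u : Cu₂) ≠ 1 ∧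
    (t : Cu₂) = sWord m * u * star (sWord n)

/-- `t` is without symmetric core if it is not a proper symmetric expansion of any element. -/
def WithoutSymmetricCore (t : Cu₂Star) : Prop :=
  ∀ r : Cu₂Star, ¬ IsProperSymmetricExpansion t r

end Cuntz

end

/-! The implications run 1 → 3 → 2 → 1. For 1 → 3 it is enough that `1 ∉ 𝒥`: splitting `ℕ` into even
and odd numbers represents `Cu₂` by contractions on bounded functions so that `f₀` acts as zero, and
the kernel of the induced map is a closed ideal that contains `f₀` but not `1` (`one_notMem_𝒥`).

For 3 → 2, suppose that the sum along a sequence `n` at a coreless `s_𝐢 s_𝐣*` is `σ ≠ 0`. A small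
change makes `n` aperiodic and keeps the sum nonzero. Then the compressions of `f` by `s_{𝐢 𝐧_L}*`
and `s_{𝐣 𝐧_L}` tend to `σ • 1` (`tendsto_compress`), so one of them is invertible.

For 2 → 1, a functional that vanishes on a closed ideal containing `f₀` takes at each `s_𝐢 s_𝐣*` the
sum of its values at the two children `s_{𝐢a} s_{𝐣a}*`. Summation by parts over each tree of
expansions shows that it kills `f` (`tsum_mul_eq_zero`); Hahn–Banach concludes.

Maximality follows: an ideal not contained in `𝒥` has an element through which `1` factors. -/

namespace EllOne

/-! ### Contractive representations extend to the `ℓ¹`-algebra -/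

variable {S : Type} [MonoidWithZero S]

/-- Extend linearly by an absolutely convergent sum. A continuous linear map is determined by the
point masses, so multiplicativity can be checked on them, one factor at a time. -/
theorem exists_ringHom {B : Type*} [NormedRing B] [NormedAlgebra ℂ B] [CompleteSpace B]
    (ρ : S →* B) (h0 : ρ 0 = 0) (hρ : ∀ s, ‖ρ s‖ ≤ 1) :
    ∃ Φ : EllOne S →+* B, Continuous Φ ∧ ∀ s, Φ (δ s) = ρ s := by
  classical
  have hle : ∀ (f : EllOne S) (t : {t : S // t ≠ 0}), ‖f t • ρ t‖ ≤ ‖f t‖ := fun f t => by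
    rw [norm_smul]
    exact mul_le_of_le_one_right (norm_nonneg _) (hρ _)
  have hs : ∀ f : EllOne S, Summable fun t : {t : S // t ≠ 0} => f t • ρ t := fun f =>
    Summable.of_norm_bounded (hasSum_norm f).summable (hle f)
  let L : EllOne S →L[ℂ] B := LinearMap.mkContinuous
    { toFun := fun f => ∑' t : {t : S // t ≠ 0}, f t • ρ t
      map_add' := fun f g => by
        rw [← (hs f).tsum_add (hs g)]
        exact tsum_congr fun t => by simp [add_smul]
      map_smul' := fun c f => by
        rw [RingHom.id_apply, ← (hs f).tsum_const_smul]
        exact tsum_congr fun t => by simp [mul_smul] } 1 fun f => by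
      rw [one_mul]
      exact tsum_of_norm_bounded (hasSum_norm f) (hle f)
  have hL : ∀ s, L (δ s) = ρ s := fun s => by
    by_cases h : s = 0
    · subst h
      rw [δ_zero, map_zero, h0]
    · have e : δ s = lp.single 1 (⟨s, h⟩ : {t : S // t ≠ 0}) (1 : ℂ) := δ_of_ne ⟨s, h⟩
      change ∑' t : {t : S // t ≠ 0}, (δ s : EllOne S) t • ρ t = ρ s
      rw [tsum_eq_single (⟨s, h⟩ : {t : S // t ≠ 0}) fun t ht => by simp [e, ht]]
      simp [e]
  have h1 : ∀ s : S, ∀ g : EllOne S, L (δ s * g) = ρ s * L g := fun s g => by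
    have e : L.comp (mulL (δ s)) = (ContinuousLinearMap.mul ℂ B (ρ s)).comp L :=
      clm_ext fun t _ => by
        simp only [ContinuousLinearMap.comp_apply, mulL_apply, δ_mul_δ, hL,
          ContinuousLinearMap.mul_apply', map_mul]
    exact congrArg (fun φ => φ g) e
  have h2 : ∀ f g : EllOne S, L (f * g) = L f * L g := fun f g => by
    have e : L.comp (mulL.flip g) = ((ContinuousLinearMap.mul ℂ B).flip (L g)).comp L :=
      clm_ext fun t _ => by
        simp only [ContinuousLinearMap.comp_apply, mulL_apply, ContinuousLinearMap.flip_apply, h1,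
          hL, ContinuousLinearMap.mul_apply']
    exact congrArg (fun φ => φ f) e
  exact ⟨{ toFun := L, map_one' := by rw [one_def, hL, map_one], map_mul' := h2,
           map_zero' := map_zero L, map_add' := map_add L }, L.continuous, hL⟩

end EllOne

/-! ### A representation that kills `f₀`, and properness of `𝒥` -/

namespace Cuntz

open BoundedContinuousFunction

/-- The operator on bounded functions on `ℕ` given by `(S_i F)(2n + i) = F(n)` and
`(S_i F)(2n + 1 - i) = 0`. -/
noncomputable def spread (i : Fin 2) : (ℕ →ᵇ ℂ) →ₗ[ℂ] (ℕ →ᵇ ℂ) where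
  toFun F := ofNormedAddCommGroupDiscrete
    (fun n => if n % 2 = i then F (n / 2) else 0) ‖F‖ (fun n => by
      split_ifs
      · exact F.norm_coe_le_norm _
      · simp)
  map_add' F G := by
    ext n
    by_cases h : n % 2 = i <;> simp [h]
  map_smul' c F := by
    ext n
    by_cases h : n % 2 = i <;> simp [h]

/-- The operator on bounded functions on `ℕ` given by `(S_i* F)(n) = F(2n + i)`. -/
noncomputable def gather (i : Fin 2) : (ℕ →ᵇ ℂ) →ₗ[ℂ] (ℕ →ᵇ ℂ) where
  toFun F := ofNormedAddCommGroupDiscrete (fun n => F (2 * n + i)) ‖F‖ fun _ =>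
    F.norm_coe_le_norm _
  map_add' _ _ := rfl
  map_smul' _ _ := rfl

theorem norm_spread_le (i : Fin 2) (F : ℕ →ᵇ ℂ) : ‖spread i F‖ ≤ 1 * ‖F‖ := by
  rw [one_mul]
  refine (norm_le (norm_nonneg _)).2 fun n => ?_
  change ‖if n % 2 = i then F (n / 2) else 0‖ ≤ _
  split_ifs
  · exact F.norm_coe_le_norm _
  · simp

theorem norm_gather_le (i : Fin 2) (F : ℕ →ᵇ ℂ) : ‖gather i F‖ ≤ 1 * ‖F‖ := by
  rw [one_mul]
  exact (norm_le (norm_nonneg _)).2 fun n => F.norm_coe_le_norm _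

/-- The operators that represent the letters on bounded functions on `ℕ`. -/
noncomputable def letterOp : Letter → ((ℕ →ᵇ ℂ) →L[ℂ] (ℕ →ᵇ ℂ))
  | .s i => (spread i).mkContinuous 1 (norm_spread_le i)
  | .sStar i => (gather i).mkContinuous 1 (norm_gather_le i)
  | .zero => 0

theorem letterOp_s_apply (i : Fin 2) (F : ℕ →ᵇ ℂ) (n : ℕ) :
    letterOp (.s i) F n = if n % 2 = i then F (n / 2) else 0 := rfl

theorem letterOp_sStar_apply (i : Fin 2) (F : ℕ →ᵇ ℂ) (n : ℕ) :
    letterOp (.sStar i) F n = F (2 * n + i) := rfl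

theorem norm_letterOp_le (x : Letter) : ‖letterOp x‖ ≤ 1 := by
  cases x with
  | s i => exact LinearMap.mkContinuous_norm_le _ zero_le_one (norm_spread_le i)
  | sStar i => exact LinearMap.mkContinuous_norm_le _ zero_le_one (norm_gather_le i)
  | zero => simp [letterOp]

/-- The representation of `Cu₂` on bounded functions on `ℕ`. -/
noncomputable def rep : Cu₂ →* ((ℕ →ᵇ ℂ) →L[ℂ] (ℕ →ᵇ ℂ)) :=
  PresentedMonoid.lift letterOp (by
    intro a b h
    cases h with
    | star_mul_self i =>
      change letterOp (.sStar i) * letterOp (.s i) = 1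
      ext F n
      have h1 : (2 * n + (i : ℕ)) % 2 = i := by have := i.2; omega
      have h2 : (2 * n + (i : ℕ)) / 2 = n := by have := i.2; omega
      simp [letterOp_s_apply, letterOp_sStar_apply, h1, h2]
    | star_mul_of_ne i j h =>
      change letterOp (.sStar i) * letterOp (.s j) = 0
      ext F n
      have h1 : (2 * n + (i : ℕ)) % 2 ≠ j := by
        have := i.2
        have := Fin.val_ne_of_ne h
        omega
      change letterOp (.sStar i) (letterOp (.s j) F) n = 0
      rw [letterOp_sStar_apply, letterOp_s_apply, if_neg h1]
    | zero_mul x => exact zero_mul (letterOp x)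
    | mul_zero x => exact mul_zero (letterOp x))

theorem rep_ofLetter (x : Letter) : rep (Cu₂.ofLetter x) = letterOp x := rfl

theorem norm_rep_le (t : Cu₂) : ‖rep t‖ ≤ 1 := by
  induction t using Cu₂.letter_induction with
  | one => rw [map_one]; exact ContinuousLinearMap.norm_id_le
  | mul x t ih =>
    rw [map_mul, rep_ofLetter]
    exact (norm_mul_le _ _).trans (mul_le_one₀ (norm_letterOp_le x) (norm_nonneg _) ih)

theorem one_notMem_𝒥 : (1 : 𝒜) ∉ 𝒥 := by
  obtain ⟨Φ, hc, hΦ⟩ := EllOne.exists_ringHom (S := Cu₂)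
    (B := (ℕ →ᵇ ℂ) →L[ℂ] (ℕ →ᵇ ℂ)) rep rfl norm_rep_le
  intro h
  suffices h1 : (1 : 𝒜) ∈ TwoSidedIdeal.ker Φ by
    rw [TwoSidedIdeal.mem_ker, map_one] at h1
    have h2 : (1 : (ℕ →ᵇ ℂ) →L[ℂ] (ℕ →ᵇ ℂ)) (const ℕ 1) 0 = 0 := by rw [h1]; rfl
    exact one_ne_zero (h2 : (1 : ℂ) = 0)
  refine (TwoSidedIdeal.mem_sInf _).1 h _ ⟨?_, ?_⟩
  · have : ((TwoSidedIdeal.ker Φ : TwoSidedIdeal 𝒜) : Set 𝒜) = Φ ⁻¹' {0} := by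
      ext x
      simp [TwoSidedIdeal.mem_ker]
    rw [this]
    exact isClosed_singleton.preimage hc
  · rw [TwoSidedIdeal.mem_ker, f₀, map_sub, map_sub, hΦ, hΦ, hΦ, map_one, map_mul, map_mul,
      Cu₂.star_s, Cu₂.star_s, Cu₂.s, Cu₂.s]
    simp only [rep_ofLetter]
    ext F n
    -- At each `n` exactly one of the two range projections returns `F n`, according to parity, and
    -- the other returns `0`.
    rcases Nat.mod_two_eq_zero_or_one n with h | h
    · have h2 : 2 * (n / 2) = n := by omega
      simp [letterOp_s_apply, letterOp_sStar_apply, h, h2]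
    · have h2 : 2 * (n / 2) + 1 = n := by omega
      simp [letterOp_s_apply, letterOp_sStar_apply, h, h2]

end Cuntz

/-! ### Summation over the binary tree of finite words -/

namespace Cuntz

open Filter Topology Finset

theorem initial_succ (n : ℕ → Fin 2) (l : ℕ) : initial n (l + 1) = initial n l ++ [n l] := by
  rw [initial, List.ofFn_succ', List.concat_eq_append]
  rfl

theorem length_initial (n : ℕ → Fin 2) (l : ℕ) : (initial n l).length = l := by simp [initial]

theorem initial_congr {m n : ℕ → Fin 2} {l : ℕ} (h : ∀ k < l, m k = n k) :
    initial m l = initial n l :=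
  congrArg List.ofFn (funext fun k => h k k.2)

/-- The infinite sequence that continues a finite one by zeros. -/
def extend {L : ℕ} (w : Fin L → Fin 2) (k : ℕ) : Fin 2 := if h : k < L then w ⟨k, h⟩ else 0

theorem initial_extend {L : ℕ} (w : Fin L → Fin 2) : initial (extend w) L = List.ofFn w :=
  congrArg List.ofFn (funext fun k => by simp [extend])

theorem extend_snoc {L : ℕ} (w : Fin L → Fin 2) (a : Fin 2) {k : ℕ} (h : k < L) :
    extend (Fin.snoc w a : Fin (L + 1) → Fin 2) k = extend w k := by
  simp [extend, Fin.snoc, h, h.trans (Nat.lt_succ_self L)]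

theorem summable_sum_words {g : List (Fin 2) → ℂ} (hg : Summable fun w => ‖g w‖) :
    Summable fun l : ℕ => ∑ w : Fin l → Fin 2, ‖g (List.ofFn w)‖ := by
  have h := ((List.equivSigmaTuple (α := Fin 2)).symm.summable_iff.2 hg).sigma
  simp only [tsum_fintype] at h
  exact h

/-- The bound is uniform in `n`, which later allows dominated convergence while `n` varies. -/
theorem norm_initial_le (g : List (Fin 2) → ℂ) (n : ℕ → Fin 2) (l : ℕ) :
    ‖g (initial n l)‖ ≤ ∑ w : Fin l → Fin 2, ‖g (List.ofFn w)‖ :=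
  single_le_sum (f := fun w : Fin l → Fin 2 => ‖g (List.ofFn w)‖) (fun _ _ => norm_nonneg _)
    (mem_univ fun k : Fin l => n k)

theorem summable_norm_initial {g : List (Fin 2) → ℂ} (hg : Summable fun w => ‖g w‖)
    (n : ℕ → Fin 2) : Summable fun l => ‖g (initial n l)‖ :=
  Summable.of_nonneg_of_le (fun _ => norm_nonneg _) (norm_initial_le g n) (summable_sum_words hg)

theorem summable_initial {g : List (Fin 2) → ℂ} (hg : Summable fun w => ‖g w‖) (n : ℕ → Fin 2) :
    Summable fun l => g (initial n l) :=
  (summable_norm_initial hg n).of_norm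

theorem sum_words_succ {M : Type*} [AddCommMonoid M] {L : ℕ} (F : (Fin (L + 1) → Fin 2) → M) :
    ∑ w, F w = ∑ w : Fin L → Fin 2, ∑ a : Fin 2, F (Fin.snoc w a) := by
  rw [← (Fin.snocEquiv fun _ => Fin 2).sum_comp, Fintype.sum_prod_type_right]
  rfl

theorem ofFn_snoc {L : ℕ} (w : Fin L → Fin 2) (a : Fin 2) :
    List.ofFn (Fin.snoc w a : Fin (L + 1) → Fin 2) = List.ofFn w ++ [a] := by
  rw [List.ofFn_succ', List.concat_eq_append]
  simp

/-- Summation by parts over the words of length at most `L`. -/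
theorem sum_words_mul {g ψ : List (Fin 2) → ℂ} (hψ : ∀ w, ψ w = ∑ a : Fin 2, ψ (w ++ [a]))
    (L : ℕ) :
    ∑ l ∈ range (L + 1), ∑ w : Fin l → Fin 2, g (List.ofFn w) * ψ (List.ofFn w) =
      ∑ w : Fin L → Fin 2,
        (∑ l ∈ range (L + 1), g (initial (extend w) l)) * ψ (List.ofFn w) := by
  induction L with
  | zero => simp [initial]
  | succ L ih =>
    rw [sum_range_succ, ih]
    simp only [sum_range_succ _ (L + 1), add_mul, sum_add_distrib, initial_extend]
    congr 1
    rw [sum_words_succ]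
    refine sum_congr rfl fun w _ => ?_
    rw [hψ, mul_sum]
    refine sum_congr rfl fun a _ => ?_
    rw [ofFn_snoc]
    congr 1
    -- Initial segments of length at most `L` do not see the new last letter `a`.
    refine sum_congr rfl fun l hl => ?_
    rw [initial_congr fun k hk => extend_snoc w a (hk.trans_le (Nat.lt_succ_iff.1 (mem_range.1 hl)))]

/-- The whole series sums to zero, so a partial sum is minus its tail. -/
theorem norm_sum_initial_le {g : List (Fin 2) → ℂ} (hg : Summable fun w => ‖g w‖)
    {n : ℕ → Fin 2} (h0 : HasSum (fun l => g (initial n l)) 0) (L : ℕ) :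
    ‖∑ l ∈ range L, g (initial n l)‖ ≤ ∑' l, ‖g (initial n (l + L))‖ := by
  have h := h0.summable.sum_add_tsum_nat_add L
  rw [h0.tsum_eq] at h
  rw [eq_neg_of_add_eq_zero_left h, norm_neg]
  exact norm_tsum_le_tsum_norm ((summable_nat_add_iff L).2 (summable_norm_initial hg n))

theorem initial_extend_injective {L l : ℕ} (h : L ≤ l) :
    Function.Injective fun (w : Fin L → Fin 2) (k : Fin l) => extend w k := by
  intro w w' e
  funext k
  have := congrFun e ⟨k, k.2.trans_le h⟩
  simpa [extend] using this

/-- Here `ψ` is a bounded, finitely additive function on cylinder sets. Its total variation may be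
infinite, so it cannot be integrated as a measure. Instead, summation by parts leaves at level `L`
one partial sum of `g` for each word of length `L`, which is minus a tail. Tails of different words
run through disjoint sets of words, so together they are at most `C` times the mass of `g` on words
longer than `L`. -/
theorem tsum_mul_eq_zero {g ψ : List (Fin 2) → ℂ} (hg : Summable fun w => ‖g w‖)
    (h0 : ∀ n, HasSum (fun l => g (initial n l)) 0)
    (hψ : ∀ w, ψ w = ∑ a : Fin 2, ψ (w ++ [a])) {C : ℝ} (hC : ∀ w, ‖ψ w‖ ≤ C) :
    ∑' w, g w * ψ w = 0 := by
  have hC0 : 0 ≤ C := (norm_nonneg _).trans (hC [])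
  have hs : Summable fun w => g w * ψ w :=
    Summable.of_norm_bounded (hg.mul_right C) fun w => by
      rw [norm_mul]
      exact mul_le_mul_of_nonneg_left (hC w) (norm_nonneg _)
  have h1 : HasSum (fun l : ℕ => ∑ w : Fin l → Fin 2, g (List.ofFn w) * ψ (List.ofFn w))
      (∑' w, g w * ψ w) :=
    ((List.equivSigmaTuple (α := Fin 2)).symm.hasSum_iff.2 hs.hasSum).sigma fun l =>
      hasSum_fintype _
  have h2 := (tendsto_add_atTop_iff_nat 1).2 h1.tendsto_sum_nat
  refine tendsto_nhds_unique h2 (squeeze_zero_norm (fun L => ?_)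
    (a := fun L => (∑' l, ∑ w : Fin (l + (L + 1)) → Fin 2, ‖g (List.ofFn w)‖) * C) ?_)
  · rw [sum_words_mul hψ]
    refine (norm_sum_le _ _).trans ?_
    have hB := summable_sum_words hg
    have hB' := (summable_nat_add_iff (L + 1)).2 hB
    have hS : ∀ w : Fin L → Fin 2, Summable fun l => ‖g (initial (extend w) (l + (L + 1)))‖ :=
      fun w => (summable_nat_add_iff (L + 1)).2 (summable_norm_initial hg (extend w))
    calc ∑ w : Fin L → Fin 2,
          ‖(∑ l ∈ range (L + 1), g (initial (extend w) l)) * ψ (List.ofFn w)‖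
        ≤ ∑ w : Fin L → Fin 2, (∑' l, ‖g (initial (extend w) (l + (L + 1)))‖) * C :=
          sum_le_sum fun w _ => by
            rw [norm_mul]
            exact mul_le_mul (norm_sum_initial_le hg (h0 _) _) (hC _) (norm_nonneg _)
              (tsum_nonneg fun _ => norm_nonneg _)
      _ = (∑' l, ∑ w : Fin L → Fin 2, ‖g (initial (extend w) (l + (L + 1)))‖) * C := by
          rw [← sum_mul, Summable.tsum_finsetSum fun w _ => hS w]
      _ ≤ _ := by
          refine mul_le_mul_of_nonneg_right (Summable.tsum_le_tsum (fun l => ?_)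
            (summable_sum fun w _ => hS w) hB') hC0
          -- Distinct words of length `L` have distinct continuations, so no word of length `l + (L
          -- + 1)` is counted twice.
          have hinj := initial_extend_injective (L := L) (l := l + (L + 1)) (by omega)
          calc ∑ w : Fin L → Fin 2, ‖g (initial (extend w) (l + (L + 1)))‖
              = ∑ v ∈ univ.map ⟨_, hinj⟩, ‖g (List.ofFn v)‖ := by rw [sum_map]; rfl
            _ ≤ _ := sum_le_sum_of_subset_of_nonneg (subset_univ _) fun _ _ _ => norm_nonneg _
  · have h := (tendsto_add_atTop_iff_nat 1).2
      (tendsto_sum_nat_add fun l : ℕ => ∑ w : Fin l → Fin 2, ‖g (List.ofFn w)‖)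
    simpa using h.mul_const C

end Cuntz

/-! ### Coreless pairs, trees of expansions, and zero sums imply membership -/

namespace Cuntz

open EllOne Cu₂

theorem elt_eq_elt_iff {i j k l : List (Fin 2)} : elt i j = elt k l ↔ i = k ∧ j = l :=
  ⟨fun h => eq_of_sWord_mul_star (congrArg Subtype.val h), fun h => by rw [h.1, h.2]⟩

/-- The words `𝐢, 𝐣` have no common nonempty suffix. -/
def Coreless (i j : List (Fin 2)) : Prop := ∀ m n u, i = m ++ u → j = n ++ u → u = []

theorem sWord_mul_elt_mul_star (m n u : List (Fin 2)) :
    sWord m * (elt u u : Cu₂) * star (sWord n) = elt (m ++ u) (n ++ u) := by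
  simp [elt, sWord_append, star_mul, mul_assoc]

theorem withoutSymmetricCore_elt_iff {i j : List (Fin 2)} :
    WithoutSymmetricCore (elt i j) ↔ Coreless i j := by
  constructor
  · intro h m n u hi hj
    by_contra hu
    refine h (elt m n) ⟨m, n, elt u u, rfl, ⟨u, rfl⟩, fun h1 => hu ?_, ?_⟩
    · have h2 : elt u u = elt [] [] := Subtype.ext (h1.trans (by simp [elt, sWord_nil]))
      exact (elt_eq_elt_iff.1 h2).1
    · rw [sWord_mul_elt_mul_star, hi, hj]
  · rintro h r ⟨m, n, _, -, ⟨u, rfl⟩, hu, ht⟩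
    rw [sWord_mul_elt_mul_star] at ht
    obtain ⟨hi, hj⟩ := elt_eq_elt_iff.1 (Subtype.ext ht)
    refine hu ?_
    rw [h m n u hi hj]
    simp [elt, sWord_nil]

theorem exists_coreless (i j : List (Fin 2)) :
    ∃ m n u, Coreless m n ∧ i = m ++ u ∧ j = n ++ u := by
  induction hN : i.length using Nat.strong_induction_on generalizing i j with
  | _ N ih =>
    by_cases h : Coreless i j
    · exact ⟨i, j, [], h, by simp, by simp⟩
    · simp only [Coreless, not_forall] at h
      obtain ⟨m, n, u, rfl, rfl, hu⟩ := h
      have hu' := List.length_pos_iff.2 hu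
      obtain ⟨m', n', u', hc, rfl, rfl⟩ := ih m.length (by simp at hN; omega) m n rfl
      exact ⟨m', n', u' ++ u, hc, by simp, by simp⟩

/-- If `(𝐦, 𝐧)` is without core and `𝐦𝐮 = 𝐤𝐳`, `𝐧𝐮 = 𝐥𝐳`, then `(𝐤, 𝐥)` expands `(𝐦, 𝐧)`. -/
theorem Coreless.exists_eq_append {m n u k l z : List (Fin 2)} (h : Coreless m n)
    (hm : m ++ u = k ++ z) (hn : n ++ u = l ++ z) :
    ∃ w, k = m ++ w ∧ l = n ++ w ∧ u = w ++ z := by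
  rcases List.append_eq_append_iff.1 hm with ⟨w, rfl, rfl⟩ | ⟨w, rfl, rfl⟩
  · rw [← List.append_assoc] at hn
    exact ⟨w, rfl, (List.append_cancel_right hn).symm, rfl⟩
  · rw [← List.append_assoc] at hn
    have hn' := List.append_cancel_right hn
    -- In this case the overlap `w` is a common suffix of `m` and `n`, hence empty.
    obtain rfl := h k l w rfl hn'
    exact ⟨[], by simp, by simpa using hn'.symm, by simp⟩

theorem Coreless.append_inj {m n u k l z : List (Fin 2)} (h : Coreless m n) (h' : Coreless k l)
    (hm : m ++ u = k ++ z) (hn : n ++ u = l ++ z) : m = k ∧ n = l ∧ u = z := by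
  obtain ⟨w, rfl, rfl, rfl⟩ := h.exists_eq_append hm hn
  obtain rfl := h' m n w rfl rfl
  simp

/-- This partitions `Cu₂ ∖ {◇}` into binary trees rooted at the coreless elements: a root is found
by stripping common suffixes, and it is unique by `Coreless.append_inj`. -/
theorem expansion_bijective : Function.Bijective
    fun p : {c : List (Fin 2) × List (Fin 2) // Coreless c.1 c.2} × List (Fin 2) =>
      elt (p.1.1.1 ++ p.2) (p.1.1.2 ++ p.2) := by
  constructor
  · rintro ⟨⟨⟨m, n⟩, h⟩, u⟩ ⟨⟨⟨k, l⟩, h'⟩, z⟩ e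
    obtain ⟨hm, hn⟩ := elt_eq_elt_iff.1 e
    obtain ⟨rfl, rfl, rfl⟩ := h.append_inj h' hm hn
    rfl
  · intro v
    obtain ⟨⟨i, j⟩, rfl, -⟩ := existsUnique_elt v
    obtain ⟨m, n, u, h, hi, hj⟩ := exists_coreless i j
    exact ⟨⟨⟨⟨m, n⟩, h⟩, u⟩, elt_eq_elt_iff.2 ⟨hi.symm, hj.symm⟩⟩

theorem elt_append_injective (i j : List (Fin 2)) :
    Function.Injective fun w => elt (i ++ w) (j ++ w) := fun _ _ h =>
  List.append_cancel_left (elt_eq_elt_iff.1 h).1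

theorem summable_norm_elt_append (f : 𝒜) (i j : List (Fin 2)) :
    Summable fun w => ‖f (elt (i ++ w) (j ++ w))‖ :=
  (hasSum_norm f).summable.comp_injective (elt_append_injective i j)

/-- Modulo any ideal containing `f₀`, each node of a tree is thus the sum of its two children. -/
theorem δ_mul_f₀_mul_δ (i j : List (Fin 2)) :
    δ (sWord i) * f₀ * δ (star (sWord j)) =
      (δ (elt i j : Cu₂) - ∑ a : Fin 2, δ (elt (i ++ [a]) (j ++ [a]) : Cu₂) : 𝒜) := by
  simp only [← sWord_mul_elt_mul_star, f₀, mul_sub, sub_mul, δ_mul_δ, Fin.sum_univ_two, mul_one]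
  simp [elt, sWord_cons, sWord_nil, sub_sub]

theorem mem_of_hasZeroSumsAt {I : TwoSidedIdeal 𝒜} (hI : IsClosed (I : Set 𝒜)) (h0 : f₀ ∈ I)
    {f : 𝒜} (hf : ∀ v, WithoutSymmetricCore v → HasZeroSumsAt f v) : f ∈ I := by
  let V : Submodule ℂ 𝒜 :=
    { carrier := I
      add_mem' := I.add_mem
      zero_mem' := I.zero_mem
      smul_mem' := fun c x hx => by
        have h := I.mul_mem_left (c • 1) x hx
        rwa [smul_mul_assoc, one_mul] at h }
  -- Closedness makes the quotient Hausdorff, so that functionals separate its points.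
  have : IsClosed (V : Set 𝒜) := hI
  by_contra hfI
  have hq : V.mkQL f ≠ 0 := fun h => hfI ((Submodule.Quotient.mk_eq_zero V).1 h)
  obtain ⟨φ', hφ'⟩ := SeparatingDual.exists_ne_zero (R := ℂ) hq
  set φ : 𝒜 →L[ℂ] ℂ := φ'.comp V.mkQL with hφ
  have hV : ∀ x ∈ I, φ x = 0 := fun x hx => by
    have h : V.mkQL x = 0 := (Submodule.Quotient.mk_eq_zero V).2 hx
    rw [hφ, ContinuousLinearMap.comp_apply, h, map_zero]
  have hadd : ∀ i j, φ (δ (elt i j : Cu₂)) =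
      ∑ a : Fin 2, φ (δ (elt (i ++ [a]) (j ++ [a]) : Cu₂)) := fun i j => by
    have h := hV _ (I.mul_mem_right _ (δ (star (sWord j))) (I.mul_mem_left (δ (sWord i)) _ h0))
    rwa [δ_mul_f₀_mul_δ, map_sub, map_sum, sub_eq_zero] at h
  have hC : ∀ t : Cu₂, ‖φ (δ t)‖ ≤ ‖φ‖ := fun t =>
    φ.le_of_opNorm_le_of_le le_rfl (norm_δ_le t) |>.trans_eq (mul_one _)
  have hsum : HasSum (fun t : Cu₂Star => f t * φ (δ (t : Cu₂))) (φ f) := by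
    simpa using φ.hasSum (hasSum_δ f)
  have h1 := (Equiv.ofBijective _ expansion_bijective).hasSum_iff.2 hsum
  -- The series for `φ f` splits into one sum per tree, and each of these vanishes.
  have h2 := h1.prod_fiberwise (g := fun _ => 0) fun c => by
    have hz : ∑' w, f (elt (c.1.1 ++ w) (c.1.2 ++ w)) *
        φ (δ (elt (c.1.1 ++ w) (c.1.2 ++ w) : Cu₂)) = 0 :=
      tsum_mul_eq_zero (summable_norm_elt_append f c.1.1 c.1.2)
        (hf _ (withoutSymmetricCore_elt_iff.2 c.2) _ _ rfl)
        (fun w => by simpa using hadd (c.1.1 ++ w) (c.1.2 ++ w)) fun w => hC _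
    exact hz ▸ (h1.summable.prod_factor c).hasSum
  exact hφ' (h2.unique hasSum_zero)

end Cuntz

/-! ### Compression along aperiodic sequences -/

namespace Cuntz

open EllOne Cu₂ Filter Topology

theorem prefix_or_prefix_of_star_mul_ne_zero {a b : List (Fin 2)}
    (h : star (sWord a) * sWord b ≠ 0) : a <+: b ∨ b <+: a := by
  induction a generalizing b with
  | nil => exact .inl List.nil_prefix
  | cons x a ih =>
    cases b with
    | nil => exact .inr List.nil_prefix
    | cons y b =>
      rw [sWord_cons, sWord_cons, star_mul, mul_assoc, ← mul_assoc (star (s x))] at h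
      by_cases hxy : x = y
      · subst hxy
        rw [star_s_mul_s, one_mul] at h
        simpa using ih h
      · rw [star_s_mul_s_of_ne hxy, zero_mul, mul_zero] at h
        exact absurd rfl h

theorem star_sWord_append_mul (k z : List (Fin 2)) :
    star (sWord (k ++ z)) * sWord k = star (sWord z) := by
  rw [sWord_append, star_mul, mul_assoc, star_sWord_mul_sWord, mul_one]

theorem star_mul_sWord_append (l z : List (Fin 2)) :
    star (sWord l) * sWord (l ++ z) = sWord z := by
  rw [sWord_append, ← mul_assoc, star_sWord_mul_sWord, one_mul]

theorem getElem?_initial (n : ℕ → Fin 2) {l r : ℕ} (h : r < l) :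
    (initial n l)[r]? = some (n r) := by
  simp [initial, h]

theorem initial_prefix (n : ℕ → Fin 2) {p L : ℕ} (h : p ≤ L) : initial n p <+: initial n L := by
  induction L, h using Nat.le_induction with
  | base => exact List.prefix_rfl
  | succ L _ ih => exact ih.trans ⟨[n L], (initial_succ n L).symm⟩

theorem eq_initial_of_prefix {n : ℕ → Fin 2} {L : ℕ} {w : List (Fin 2)} (h : w <+: initial n L) :
    w = initial n w.length := by
  have hle : w.length ≤ L := by simpa [length_initial] using h.length_le
  exact (List.prefix_of_prefix_length_le h (initial_prefix n hle)
    (length_initial n _).ge).eq_of_length (length_initial n _).symm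

/-- An infinite sequence is aperiodic if no two of its tails agree. -/
def Aperiodic (n : ℕ → Fin 2) : Prop := ∀ p q, p ≠ q → ∃ t, n (t + p) ≠ n (t + q)

/-- The sequence that agrees with `n` before `N` and then with the indicator of the squares. -/
noncomputable def perturb (n : ℕ → Fin 2) (N t : ℕ) : Fin 2 :=
  open scoped Classical in if t < N then n t else if IsSquare t then 1 else 0

/-- Gaps between squares grow: for `p < q` and `m = N + p + q`, the number `m² + (q - p)` lies
strictly between `m²` and `(m + 1)²`. Hence the tails from `p` and `q` differ at `t = m² - p`. -/
theorem aperiodic_perturb (n : ℕ → Fin 2) (N : ℕ) : Aperiodic (perturb n N) := by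
  have key : ∀ p q, p < q → ∃ t, perturb n N (t + p) ≠ perturb n N (t + q) := fun p q hpq => by
    have hm : N + p + q ≤ (N + p + q) * (N + p + q) := Nat.le_mul_self _
    refine ⟨(N + p + q) * (N + p + q) - p, ?_⟩
    have h1 : (N + p + q) * (N + p + q) - p + p = (N + p + q) * (N + p + q) := by omega
    have h2 : (N + p + q) * (N + p + q) - p + q = (N + p + q) * (N + p + q) + (q - p) := by omega
    have h3 : ¬ IsSquare ((N + p + q) * (N + p + q) + (q - p)) := by
      rintro ⟨r, hr⟩
      have h4 : N + p + q < r := by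
        by_contra h
        have := Nat.mul_le_mul (not_lt.1 h) (not_lt.1 h)
        omega
      have h5 := Nat.mul_le_mul (Nat.succ_le_of_lt h4) (Nat.succ_le_of_lt h4)
      have h6 : (N + p + q).succ * (N + p + q).succ =
        (N + p + q) * (N + p + q) + 2 * (N + p + q) + 1 := by rw [Nat.succ_eq_add_one]; ring
      omega
    have h7 : perturb n N ((N + p + q) * (N + p + q)) = 1 := by
      rw [perturb, if_neg (by omega), if_pos (IsSquare.mul_self _)]
    have h8 : perturb n N ((N + p + q) * (N + p + q) + (q - p)) = 0 := by
      rw [perturb, if_neg (by omega), if_neg h3]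
    rw [h1, h2, h7, h8]
    exact one_ne_zero
  intro p q hpq
  rcases hpq.lt_or_gt with h | h
  · exact key p q h
  · obtain ⟨t, ht⟩ := key q p h
    exact ⟨t, ht.symm⟩

theorem tendsto_tsum_perturb {g : List (Fin 2) → ℂ} (hg : Summable fun w => ‖g w‖)
    (n : ℕ → Fin 2) :
    Tendsto (fun N => ∑' l, g (initial (perturb n N) l)) atTop (𝓝 (∑' l, g (initial n l))) := by
  refine tendsto_tsum_of_dominated_convergence (summable_sum_words hg) (fun l => ?_)
    (.of_forall fun N l => norm_initial_le g _ l)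
  refine tendsto_const_nhds.congr' ((eventually_ge_atTop l).mono fun N hN => ?_)
  beta_reduce
  rw [initial_congr (m := perturb n N) fun k hk => by rw [perturb, if_pos (hk.trans_le hN)]]

open scoped Classical in
/-- Compressing `s_𝐤 s_𝐥*` by `s_{𝐢 𝐧_L}` and `s_{𝐣 𝐧_L}` eventually gives `e` if `s_𝐤 s_𝐥*` is one
of the `s_{𝐢 𝐧_p} s_{𝐣 𝐧_p}*`, and `◇` otherwise. -/
theorem eventually_compress_eq {i j : List (Fin 2)} (hc : Coreless i j) {n : ℕ → Fin 2}
    (hn : Aperiodic n) (v : Cu₂Star) :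
    ∀ᶠ L in atTop, star (sWord (i ++ initial n L)) * (v : Cu₂) * sWord (j ++ initial n L) =
      if v ∈ Set.range fun p => elt (i ++ initial n p) (j ++ initial n p) then 1 else 0 := by
  split_ifs with h
  · obtain ⟨p, rfl⟩ := h
    filter_upwards [eventually_ge_atTop p] with L hL
    obtain ⟨u, hu⟩ := initial_prefix n hL
    rw [← hu, ← List.append_assoc, ← List.append_assoc, elt, ← mul_assoc, star_sWord_append_mul,
      mul_assoc, star_mul_sWord_append, star_sWord_mul_sWord]
  · obtain ⟨⟨k, l⟩, rfl, -⟩ := existsUnique_elt v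
    -- If the compression is not `◇`, then `𝐢𝐧_L = 𝐤𝐳` and `𝐣𝐧_L = 𝐥𝐳'` with `𝐳`, `𝐳'` comparable.
    -- They read `n` from the offsets `|𝐤| - |𝐢|` and `|𝐥| - |𝐣|`; both are shifted by `|𝐢| + |𝐣|`
    -- to stay in `ℕ`. The position `t` must be fixed before `L`.
    obtain ⟨t, ht⟩ : ∃ t, k.length + j.length ≠ l.length + i.length →
        n (t + (k.length + j.length)) ≠ n (t + (l.length + i.length)) := by
      by_cases hpq : k.length + j.length ≠ l.length + i.length
      · exact (hn _ _ hpq).imp fun t ht _ => ht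
      · exact ⟨0, fun h => absurd h hpq⟩
    filter_upwards [eventually_gt_atTop
      (t + k.length + l.length + i.length + j.length)] with L hL
    by_contra h0
    rw [elt, ← mul_assoc, mul_assoc] at h0
    have hpre : ∀ {a b : List (Fin 2)}, b.length < L → a ++ initial n L <+: b ∨
        b <+: a ++ initial n L → ∃ z, a ++ initial n L = b ++ z := fun {a b} hb h => by
      rcases h with h | ⟨z, hz⟩
      · have := h.length_le
        rw [List.length_append, length_initial] at this
        omega
      · exact ⟨z, hz.symm⟩
    obtain ⟨z, hz⟩ := hpre (by omega)
      (prefix_or_prefix_of_star_mul_ne_zero (left_ne_zero_of_mul h0))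
    obtain ⟨z', hz'⟩ := hpre (by omega)
      (prefix_or_prefix_of_star_mul_ne_zero (right_ne_zero_of_mul h0)).symm
    rw [hz, hz', star_sWord_append_mul, star_mul_sWord_append] at h0
    have hzl := congrArg List.length hz
    have hzl' := congrArg List.length hz'
    simp only [List.length_append, length_initial] at hzl hzl'
    have hcomp := prefix_or_prefix_of_star_mul_ne_zero h0
    -- Equal offsets force `z = z'`, and corelessness puts `(𝐤, 𝐥)` on the branch. Unequal offsets
    -- make two different tails of `n` agree at `t`, against the choice of `t`.
    by_cases hpq : k.length + j.length = l.length + i.length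
    · have hlen : z.length = z'.length := by omega
      have e : z = z' := hcomp.elim (fun h => h.eq_of_length hlen)
        fun h => (h.eq_of_length hlen.symm).symm
      subst e
      obtain ⟨w, rfl, rfl, hw⟩ := hc.exists_eq_append hz hz'
      exact h ⟨w.length, by
        change elt (i ++ initial n w.length) (j ++ initial n w.length) = _
        rw [← eq_initial_of_prefix ⟨z, hw.symm⟩]⟩
    · refine ht hpq (Option.some.inj ?_)
      have hr : ∀ {a b x : List (Fin 2)} (c : ℕ), a ++ initial n L = b ++ x →
          t + (b.length + c) < L → x[t + a.length + c]? = some (n (t + (b.length + c))) :=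
        fun {a b x} c hx hlt => by
          have h1 := congrArg (fun y => y[b.length + (t + a.length + c)]?) hx
          beta_reduce at h1
          rw [List.getElem?_append_right (by omega), List.getElem?_append_right (by omega),
            getElem?_initial n (by omega)] at h1
          rw [show b.length + (t + a.length + c) - b.length = t + a.length + c by omega] at h1
          rw [← h1]
          congr 2
          omega
      rw [← hr j.length hz (by omega), ← hr i.length hz' (by omega),
        show t + j.length + i.length = t + i.length + j.length by omega]
      rcases hcomp with ⟨y, rfl⟩ | ⟨y, rfl⟩
      · rw [List.getElem?_append_left (by omega)]
      · rw [List.getElem?_append_left (by omega)]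

theorem hasSum_δ_mul_mul_δ (f : 𝒜) (a b : Cu₂) :
    HasSum (fun t : Cu₂Star => f t • (δ (a * t * b) : 𝒜)) (δ a * f * δ b) := by
  have h := ((mulL.flip (δ b)).comp (mulL (δ a))).hasSum (hasSum_δ f)
  simpa [mulL_apply, δ_mul_δ] using h

/-- Dominated convergence over `Cu₂ ∖ {◇}`: each term is eventually constant by
`eventually_compress_eq` and bounded by `‖f t‖`. Only the terms on the branch survive. -/
theorem tendsto_compress (f : 𝒜) {i j : List (Fin 2)} (hc : Coreless i j) {n : ℕ → Fin 2}
    (hn : Aperiodic n) :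
    Tendsto (fun L => δ (star (sWord (i ++ initial n L))) * f * δ (sWord (j ++ initial n L)))
      atTop (𝓝 ((∑' l, f (elt (i ++ initial n l) (j ++ initial n l))) • (1 : 𝒜))) := by
  classical
  have hinj : Function.Injective fun p => elt (i ++ initial n p) (j ++ initial n p) :=
    fun p q h => by
      simpa [length_initial] using congrArg List.length (elt_append_injective i j h)
  have hlim : ∑' t : Cu₂Star, f t • (δ (if t ∈ Set.range fun p =>
      elt (i ++ initial n p) (j ++ initial n p) then 1 else 0) : 𝒜) =
      (∑' l, f (elt (i ++ initial n l) (j ++ initial n l))) • (1 : 𝒜) := by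
    refine (HasSum.tsum_eq ((hinj.hasSum_iff fun t ht => ?_).1 ?_))
    · rw [if_neg ht, δ_zero, smul_zero]
    · have hs := (summable_initial (summable_norm_elt_append f i j) n).hasSum.smul_const (1 : 𝒜)
      convert hs using 2 with p
      rw [Function.comp_apply, if_pos ⟨p, rfl⟩, one_def]
  rw [← hlim]
  simp only [← (hasSum_δ_mul_mul_δ f _ _).tsum_eq]
  refine tendsto_tsum_of_dominated_convergence (hasSum_norm f).summable (fun t => ?_)
    (.of_forall fun L t => ?_)
  · exact tendsto_const_nhds.congr' ((eventually_compress_eq hc hn t).mono fun L hL => by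
      beta_reduce
      rw [hL])
  · rw [norm_smul]
    exact mul_le_of_le_one_right (norm_nonneg _) (norm_δ_le _)

theorem exists_mul_mul_eq_one {f : 𝒜} {v : Cu₂Star} (hv : WithoutSymmetricCore v)
    (hf : ¬ HasZeroSumsAt f v) : ∃ g h : 𝒜, g * f * h = 1 := by
  simp only [HasZeroSumsAt, not_forall] at hf
  obtain ⟨i, j, rfl, n, hn⟩ := hf
  have hc := withoutSymmetricCore_elt_iff.1 hv
  have hg := summable_norm_elt_append f i j
  -- The series converges absolutely, so zero sums can fail only through a nonzero value.
  have hne : ∑' l, f (elt (i ++ initial n l) (j ++ initial n l)) ≠ 0 := fun h =>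
    hn (h ▸ (summable_initial hg n).hasSum)
  obtain ⟨N, hN⟩ := ((tendsto_tsum_perturb hg n).eventually_ne hne).exists
  have hu : IsUnit ((∑' l, f (elt (i ++ initial (perturb n N) l)
      (j ++ initial (perturb n N) l))) • (1 : 𝒜)) := by
    rw [← Algebra.algebraMap_eq_smul_one]
    exact (IsUnit.mk0 _ hN).map _
  -- The limit is a nonzero multiple of `1` and the units are open, so some compression is a unit
  -- `u`.
  obtain ⟨L, u, hL⟩ := ((tendsto_compress f hc (aperiodic_perturb n N)).eventually
    (Units.isOpen.mem_nhds hu)).exists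
  refine ⟨↑u⁻¹ * δ (star (sWord (i ++ initial (perturb n N) L))),
    δ (sWord (j ++ initial (perturb n N) L)), ?_⟩
  rw [mul_assoc, mul_assoc, ← mul_assoc (δ (star _)), ← hL, Units.inv_mul]

/-! ### The equivalences and maximality -/

theorem one_mem_of_mul_mul_eq_one {I : TwoSidedIdeal 𝒜} {f g h : 𝒜} (hf : f ∈ I)
    (e : g * f * h = 1) : (1 : 𝒜) ∈ I :=
  e ▸ I.mul_mem_right _ h (I.mul_mem_left g _ hf)

theorem tfae_mem_𝒥 (f : 𝒜) : List.TFAE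
    [f ∈ 𝒥, ∀ v : Cu₂Star, WithoutSymmetricCore v → HasZeroSumsAt f v,
      ¬ ∃ g h : 𝒜, g * f * h = δ 1] := by
  tfae_have 1 → 3 := fun hf ⟨g, h, e⟩ => one_notMem_𝒥 (one_mem_of_mul_mul_eq_one hf e)
  tfae_have 3 → 2 := fun h v hv => by
    by_contra hf
    exact h (exists_mul_mul_eq_one hv hf)
  tfae_have 2 → 1 := fun h => (TwoSidedIdeal.mem_sInf _).2 fun I hI =>
    mem_of_hasZeroSumsAt hI.1 hI.2 h
  tfae_finish

/-- The ideal `I` need not be closed, so `𝒥` is the largest among all proper two-sided ideals. -/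
theorem eq_top_of_not_le_𝒥 {I : TwoSidedIdeal 𝒜} (h : ¬ I ≤ 𝒥) : I = ⊤ := by
  obtain ⟨f, hfI, hf⟩ := SetLike.not_le_iff_exists.1 h
  obtain ⟨b, c, e⟩ := not_not.1 (mt ((tfae_mem_𝒥 f).out 0 2).2 hf)
  exact I.one_mem_iff.1 (one_mem_of_mul_mul_eq_one hfI e)

theorem 𝒥_ne_top : 𝒥 ≠ ⊤ := fun h => one_notMem_𝒥 (h ▸ (⊤ : TwoSidedIdeal 𝒜).one_mem_iff.2 rfl)

end Cuntz

theorem theorem3p12 :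
    (∀ f : Cuntz.𝒜,
      List.TFAE
        [f ∈ Cuntz.𝒥,
         ∀ v : Cuntz.Cu₂Star, Cuntz.WithoutSymmetricCore v → Cuntz.HasZeroSumsAt f v,
         ¬ ∃ g h : Cuntz.𝒜, g * f * h = EllOne.δ 1]) ∧
    (Cuntz.𝒥 : Set Cuntz.𝒜) = Cuntz.nonFactoring Cuntz.𝒜 ∧
    IsCoatom Cuntz.𝒥 ∧ ∀ I : TwoSidedIdeal Cuntz.𝒜, IsCoatom I → I = Cuntz.𝒥 := by
  refine ⟨Cuntz.tfae_mem_𝒥, Set.ext fun f => (Cuntz.tfae_mem_𝒥 f).out 0 2,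
    ⟨Cuntz.𝒥_ne_top, fun I hI => Cuntz.eq_top_of_not_le_𝒥 hI.not_ge⟩, fun I hI => ?_⟩
  by_contra hne
  have hle : I ≤ Cuntz.𝒥 := by
    by_contra h
    exact hI.1 (Cuntz.eq_top_of_not_le_𝒥 h)
  exact Cuntz.𝒥_ne_top (hI.2 _ (lt_of_le_of_ne hle hne))
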